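/- Let $\mathbb V,\mathbb X,\mathbb Y$ be Euclidean spaces (finite-dimensional real inner product spaces), where $\mathbb X$ and $\mathbb Y$ carry Euclidean Jordan algebra structures: a bilinear commutative product $\circ$ with unit $e$, satisfying $(x\circ y)\circ(x\circ x)=x\circ(y\circ(x\circ x))$ and $\langle x\circ y,z\rangle=\langle y,x\circ z\rangle$. Let $K_{\mathbb X}=\{x\circ x:x\in\mathbb X\}$ and $\Delta_{\mathbb X}=\{x\in K_{\mathbb X}:\langle e_{\mathbb X},x\rangle=1\}$ (the spectraplex), and likewise $K_{\mathbb Y},\Delta_{\mathbb Y}$. Let $G:\mathbb X\to\mathbb V$ and $H:\mathbb Y\to\mathbb V$ be linear maps such that $P=G(K_{\mathbb X})$ and $Q=H(K_{\mathbb Y})$ are LISC cones: $P$ and $Q$ are closed pointed convex cones, and $G(c)\ne0$, $H(c')\neq 0$ for all primitive idempotents $c\in\mathbb X$, $c'\in\mathbb Y$ (a primitive idempotent is a non-zero idempotent that is not the sum of two non-zero idempotents). Put $$\Phi(x,y)=\frac{\langle Gx,Hy\rangle}{\|Gx\|\,\|Hy\|}$$ and consider the fractional program: minimize $\Phi(x,y)$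 over $(x,y)\in\Delta_{\mathbb X}\times\Delta_{\mathbb Y}$. A point $(\bar x,\bar y)$ is a stationary point of it if $\Phi$ is differentiable at $(\bar x,\bar y)$, $\langle e_{\mathbb X},\bar x\rangle=1$, $\langle e_{\mathbb Y},\bar y\rangle=1$, and there are $\gamma_1,\gamma_2\in\mathbb R$ with $$K_{\mathbb X}\ni\bar x\perp\nabla_x\Phi(\bar x,\bar y)+\gamma_1e_{\mathbb X}\in K_{\mathbb X}^*,\qquad K_{\mathbb Y}\ni\bar y\perp\nabla_y\Phi(\bar x,\bar y)+\gamma_2e_{\mathbb Y}\in K_{\mathbb Y}^*,$$ where $K^*=\{\zeta:\langle\zeta,u\rangle\ge0\ \forall u\in K\}$. Let $\beta>0$, $0<\alpha<1$, $0<\rho<1$, $\mu_1,\mu_2\ge0$, and let $\{(x^k,y^k)\}_{k\geq 0}$ be generated by the Sequential Regularized Partial Linearization algorithm: $(x^0,y^0)\in\Delta_{\mathbb X}\times\Delta_{\mathbb Y}$ is arbitrary, and for each $k$, with $\delta_k=\Phi(x^k,y^k)$, $$L_1^k(x)=\langle Gx,Hy^k-\delta_k\|Gx^k\|^{-1}\|Hy^k\|Gx^k\rangle,\qquad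 L_2^k(y)=\langle Hy,Gx^k-\delta_k\|Gx^k\|\|Hy^k\|^{-1}Hy^k\rangle,$$ one takes any minimizer $\tilde x^k$ of $L_1^k(x)+\frac{\mu_1}2\|x-x^k\|^2$ over $\Delta_{\mathbb X}$ and any minimizer $\tilde y^k$ of $L_2^k(y)+\frac{\mu_2}2\|y-y^k\|^2$ over $\Delta_{\mathbb Y}$, and sets $d_1^k=\tilde x^k-x^k$, $d_2^k=\tilde y^k-y^k$. If $L_1^k(d_1^k)=0=L_2^k(d_2^k)$, the algorithm terminates (and the sequence is continued constantly). Otherwise $(x^{k+1},y^{k+1})=(x^k,y^k)+t_k(d_1^k,d_2^k)$ with $t_k=\beta\rho^{\ell_k}$, where $\ell_k$ is the smallest integer $\ell\ge0$ such that $t=\beta\rho^\ell$ satisfies $$\Phi(x^k+td_1^k,y^k+td_2^k)\le\Phi(x^k,y^k)+\alpha t\,\frac{L_1^k(d_1^k)+L_2^k(d_2^k)}{\|Gx^k\|\,\|Hy^k\|}.$$ If $\beta>1$, assume moreover that all iterates $(x^k,y^k)$ belong to $\Delta_{\mathbb X}\times\Delta_{\mathbb Y}$ (for $\beta\le1$ this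 is automatic and is not assumed). Then the sequence $\{(x^k,y^k)\}$ has an accumulation point, and every accumulation point $(\bar x,\bar y)$ of it is a stationary point of the fractional program. Moreover, for every such $(\bar x,\bar y)$, the pair $(u,v)=(G\bar x/\|G\bar x\|,\,H\bar y/\|H\bar y\|)$ is a critical pair of $(P,Q)$, that is, $u\in P$, $v\in Q$, $\|u\|=\|v\|=1$, $v-\langle u,v\rangle u\in P^*$ and $u-\langle u,v\rangle v\in Q^*$. -/

import Mathlib

open Filter Topology
open scoped RealInnerProductSpace

/-- A Euclidean Jordan algebra structure on a Euclidean space `X`: a bilinear commutative product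
with unit, satisfying the Jordan identity, for which the inner product of `X` is associative. -/
structure EuclideanJordanAlgebra (X : Type*) [NormedAddCommGroup X] [InnerProductSpace ℝ X] where
  mul : X →ₗ[ℝ] X →ₗ[ℝ] X
  one : X
  mul_comm : ∀ x y : X, mul x y = mul y x
  one_mul : ∀ x : X, mul one x = x
  jordan : ∀ x y : X, mul (mul x y) (mul x x) = mul x (mul y (mul x x))
  inner_mul : ∀ x y z : X, ⟪mul x y, z⟫ = ⟪y, mul x z⟫

namespace EuclideanJordanAlgebra

variable {X : Type*} [NormedAddCommGroup X] [InnerProductSpace ℝ X]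

/-- The symmetric cone of the algebra: the set of squares. -/
def symmCone (J : EuclideanJordanAlgebra X) : Set X :=
  {z | ∃ x : X, z = J.mul x x}

/-- The spectraplex: elements of the symmetric cone with `⟨e, x⟩ = 1`. -/
def spectraplex (J : EuclideanJordanAlgebra X) : Set X :=
  {x | x ∈ J.symmCone ∧ ⟪J.one, x⟫ = 1}

/-- `c` is idempotent. -/
def IsIdem (J : EuclideanJordanAlgebra X) (c : X) : Prop :=
  J.mul c c = c

/-- `c` is a primitive idempotent: a non-zero idempotent that is not the sum of two non-zero
idempotents. -/
def IsPrimitiveIdem (J : EuclideanJordanAlgebra X) (c : X) : Prop :=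
  J.IsIdem c ∧ c ≠ 0 ∧
    ¬ ∃ a b : X, J.IsIdem a ∧ J.IsIdem b ∧ a ≠ 0 ∧ b ≠ 0 ∧ c = a + b

end EuclideanJordanAlgebra

/-- The closed convex cone `P` is the LISC cone `G(K_X)`: it is the image of the symmetric cone of
the Euclidean Jordan algebra under the linear map `G`, no primitive idempotent is mapped to zero,
and `P` is pointed. (`ProperCone ℝ V` is Mathlib's type of nonempty closed convex cones.) -/
structure IsLISC {V X : Type*} [NormedAddCommGroup V] [InnerProductSpace ℝ V]
    [NormedAddCommGroup X] [InnerProductSpace ℝ X]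
    (P : ProperCone ℝ V) (J : EuclideanJordanAlgebra X) (G : X →ₗ[ℝ] V) : Prop where
  image_eq : G '' J.symmCone = (P : Set V)
  map_ne_zero : ∀ c : X, J.IsPrimitiveIdem c → G c ≠ 0
  pointed : (P : Set V) ∩ {u : V | -u ∈ P} = {0}

/-- The dual cone of a subset of a Euclidean space. -/
def dualCone {E : Type*} [NormedAddCommGroup E] [InnerProductSpace ℝ E] (K : Set E) : Set E :=
  {ζ | ∀ u ∈ K, 0 ≤ ⟪ζ, u⟫}

/-- `(u, v)` is a critical pair of the cones `(P, Q)`. -/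
structure IsCriticalPair {V : Type*} [NormedAddCommGroup V] [InnerProductSpace ℝ V]
    (P Q : ProperCone ℝ V) (u v : V) : Prop where
  u_mem : u ∈ P
  norm_u : ‖u‖ = 1
  v_mem : v ∈ Q
  norm_v : ‖v‖ = 1
  u_compl : v - ⟪u, v⟫ • u ∈ dualCone (P : Set V)
  v_compl : u - ⟪u, v⟫ • v ∈ dualCone (Q : Set V)

/-- The gradient of a real function on a Euclidean space. -/
noncomputable def grad {E : Type*} [NormedAddCommGroup E] [InnerProductSpace ℝ E]
    [FiniteDimensional ℝ E] (f : E → ℝ) (x : E) : E :=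
  haveI : CompleteSpace E := FiniteDimensional.complete ℝ E
  gradient f x

/-- `(x, y)` is a stationary point of the problem: minimize `Ψ (x, y)` subject to `x ∈ KX`,
`φ₁ x = 0`, `y ∈ KY`, `φ₂ y = 0`. Differentiability at the point is part of the definition, so
that the gradients are genuine. -/
def IsStationaryPoint {X Y : Type*} [NormedAddCommGroup X] [InnerProductSpace ℝ X]
    [FiniteDimensional ℝ X] [NormedAddCommGroup Y] [InnerProductSpace ℝ Y]
    [FiniteDimensional ℝ Y] (KX : Set X) (KY : Set Y) (Ψ : X × Y → ℝ) (φ₁ : X → ℝ) (φ₂ : Y → ℝ)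
    (x : X) (y : Y) : Prop :=
  DifferentiableAt ℝ Ψ (x, y) ∧ DifferentiableAt ℝ φ₁ x ∧ DifferentiableAt ℝ φ₂ y ∧
  ∃ γ₁ γ₂ : ℝ,
    (x ∈ KX ∧ ⟪x, grad (fun x' => Ψ (x', y)) x + γ₁ • grad φ₁ x⟫ = 0 ∧
      grad (fun x' => Ψ (x', y)) x + γ₁ • grad φ₁ x ∈ dualCone KX) ∧
    (y ∈ KY ∧ ⟪y, grad (fun y' => Ψ (x, y')) y + γ₂ • grad φ₂ y⟫ = 0 ∧
      grad (fun y' => Ψ (x, y')) y + γ₂ • grad φ₂ y ∈ dualCone KY) ∧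
    φ₁ x = 0 ∧ φ₂ y = 0

section Algorithm

variable {V X Y : Type*} [NormedAddCommGroup V] [InnerProductSpace ℝ V]
  [NormedAddCommGroup X] [InnerProductSpace ℝ X]
  [NormedAddCommGroup Y] [InnerProductSpace ℝ Y]

/-- The objective `Φ(x, y) = ⟨Gx, Hy⟩ / (‖Gx‖ ‖Hy‖)` of the fractional program. -/
noncomputable def fracObj (G : X →ₗ[ℝ] V) (H : Y →ₗ[ℝ] V) (p : X × Y) : ℝ :=
  ⟪G p.1, H p.2⟫ / (‖G p.1‖ * ‖H p.2‖)

/-- Stationary point of the fractional program: minimize `Φ` over the product of the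
spectraplexes. -/
def IsFracStationary [FiniteDimensional ℝ X] [FiniteDimensional ℝ Y]
    (JX : EuclideanJordanAlgebra X) (JY : EuclideanJordanAlgebra Y)
    (G : X →ₗ[ℝ] V) (H : Y →ₗ[ℝ] V) (x : X) (y : Y) : Prop :=
  IsStationaryPoint JX.symmCone JY.symmCone (fracObj G H)
    (fun x' => ⟪JX.one, x'⟫ - 1) (fun y' => ⟪JY.one, y'⟫ - 1) x y

/-- The partial linearization `L₁` at the iterate `(xk, yk)`, with `δ = Φ(xk, yk)`. -/
noncomputable def linX (G : X →ₗ[ℝ] V) (H : Y →ₗ[ℝ] V) (xk : X) (yk : Y) (x : X) : ℝ :=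
  ⟪G x, H yk - (fracObj G H (xk, yk) * ‖G xk‖⁻¹ * ‖H yk‖) • G xk⟫

/-- The partial linearization `L₂` at the iterate `(xk, yk)`, with `δ = Φ(xk, yk)`. -/
noncomputable def linY (G : X →ₗ[ℝ] V) (H : Y →ₗ[ℝ] V) (xk : X) (yk : Y) (y : Y) : ℝ :=
  ⟪H y, G xk - (fracObj G H (xk, yk) * ‖G xk‖ * ‖H yk‖⁻¹) • H yk⟫

/-- `z` is a (global) solution of: minimize `f` over `S`. -/
def IsSolution {E : Type*} (f : E → ℝ) (S : Set E) (z : E) : Prop :=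
  z ∈ S ∧ ∀ w ∈ S, f z ≤ f w

/-- The Armijo inequality at the point `(x, y)` for the direction `(d₁, d₂)` and step `t`. -/
def Armijo (G : X →ₗ[ℝ] V) (H : Y →ₗ[ℝ] V) (α : ℝ) (x : X) (y : Y) (d₁ : X) (d₂ : Y)
    (t : ℝ) : Prop :=
  fracObj G H (x + t • d₁, y + t • d₂) ≤
    fracObj G H (x, y) + α * t * ((linX G H x y d₁ + linY G H x y d₂) / (‖G x‖ * ‖H y‖))

/-- `(x, y)` is a sequence of iterates of the Sequential Regularized Partial Linearization
algorithm with parameters `β, α, ρ, μ₁, μ₂`, where `xt, yt` are the subproblem solutions that were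
selected. Any solutions of the subproblems are allowed. When the stopping test succeeds, the
sequence stays constant: the run has terminated at that iterate. -/
structure IsSRPLRun (JX : EuclideanJordanAlgebra X) (JY : EuclideanJordanAlgebra Y)
    (G : X →ₗ[ℝ] V) (H : Y →ₗ[ℝ] V) (β α ρ μ₁ μ₂ : ℝ)
    (x xt : ℕ → X) (y yt : ℕ → Y) : Prop where
  init_x : x 0 ∈ JX.spectraplex
  init_y : y 0 ∈ JY.spectraplex
  sub_x : ∀ k, IsSolution (fun z => linX G H (x k) (y k) z + μ₁ / 2 * ‖z - x k‖ ^ 2)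
    JX.spectraplex (xt k)
  sub_y : ∀ k, IsSolution (fun z => linY G H (x k) (y k) z + μ₂ / 2 * ‖z - y k‖ ^ 2)
    JY.spectraplex (yt k)
  halt : ∀ k, linX G H (x k) (y k) (xt k - x k) = 0 → linY G H (x k) (y k) (yt k - y k) = 0 →
    x (k + 1) = x k ∧ y (k + 1) = y k
  step : ∀ k, ¬ (linX G H (x k) (y k) (xt k - x k) = 0 ∧ linY G H (x k) (y k) (yt k - y k) = 0) →
    ∃ l : ℕ,
      IsLeast {j : ℕ | Armijo G H α (x k) (y k) (xt k - x k) (yt k - y k) (β * ρ ^ j)} l ∧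
      x (k + 1) = x k + (β * ρ ^ l) • (xt k - x k) ∧
      y (k + 1) = y k + (β * ρ ^ l) • (yt k - y k)

end Algorithm

/-! Dividing `linX + linY` by `‖Gx‖‖Hy‖` gives exactly the directional derivative of `Φ`
(`fderiv_fracObj`), and `linX` vanishes at its own base point (`linX_self`) because `Φ` is
homogeneous of degree 0. The subproblems therefore give non-ascent directions, `Φ` decreases along
the run, and, being at least -1, its decrements tend to 0. Near an accumulation point the subproblem
solutions also accumulate, at solutions of the limiting subproblems. If the limiting slope `D₀` were
negative, the steps would tend to 0, so the trial step `t/ρ` would be rejected eventually; in the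
limit `α D₀ ≤ D₀`, impossible for `α < 1`. Hence the limiting linearizations are nonnegative on the
spectraplexes, and by scaling on the cones. This is stationarity with zero multipliers and, after
normalization, criticality of the pair. Two facts about Jordan algebras are needed: the spectraplex
is compact and convex, and `G`, `H` do not vanish on it. Both rest on the spectral theorem, obtained
from power associativity. -/

namespace EuclideanJordanAlgebra

/-! ### Jordan identities and power associativity. -/

section Identities

variable {X : Type*} [NormedAddCommGroup X] [InnerProductSpace ℝ X]
  (J : EuclideanJordanAlgebra X)

/-- The full linearization of the Jordan identity. -/
theorem jordan_linearized (a b c d : X) :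
    J.mul a (J.mul (J.mul b c) d) + J.mul b (J.mul (J.mul c a) d) + J.mul c (J.mul (J.mul a b) d) =
      J.mul (J.mul b c) (J.mul a d) + J.mul (J.mul c a) (J.mul b d) +
        J.mul (J.mul a b) (J.mul c d) := by
  have key : ∀ x : X, J.mul x (J.mul (J.mul x x) d) = J.mul (J.mul x x) (J.mul x d) := fun x => by
    rw [J.mul_comm (J.mul x x) d, ← J.jordan x d, J.mul_comm]
  -- `key` is cubic in `x`; inclusion-exclusion over `a`, `b`, `c` isolates its multilinear part,
  -- where commutativity makes each term occur twice.
  have h1 := key (a + b + c)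
  have h2 := key (a + b)
  have h3 := key (b + c)
  have h4 := key (c + a)
  have h5 := key a
  have h6 := key b
  have h7 := key c
  simp only [map_add, LinearMap.add_apply, J.mul_comm b a, J.mul_comm c b, J.mul_comm a c]
    at h1 h2 h3 h4 h5 h6 h7 ⊢
  linear_combination (norm := module) (1 / 2 : ℝ) • h1 - (1 / 2 : ℝ) • h2 - (1 / 2 : ℝ) • h3
    - (1 / 2 : ℝ) • h4 + (1 / 2 : ℝ) • h5 + (1 / 2 : ℝ) • h6 + (1 / 2 : ℝ) • h7

/-- Multiplication by `a ∘ (b ∘ c)` in terms of simpler multiplications. -/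
theorem mul_mul_mul_apply (a b c d : X) :
    J.mul (J.mul a (J.mul b c)) d =
      J.mul a (J.mul (J.mul b c) d) + J.mul b (J.mul (J.mul c a) d) + J.mul c (J.mul (J.mul a b) d)
        - J.mul b (J.mul a (J.mul c d)) - J.mul c (J.mul a (J.mul b d)) := by
  have h1 := J.jordan_linearized a b c d
  -- The right side of the linearized identity is symmetric in `a` and `d`, so the two left sides
  -- agree.
  have h2 := J.jordan_linearized d b c a
  rw [J.mul_comm d, J.mul_comm (J.mul b c) a, J.mul_comm (J.mul c d) a, J.mul_comm (J.mul d b) a,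
    J.mul_comm d a, J.mul_comm (J.mul c d) (J.mul b a), J.mul_comm (J.mul d b) (J.mul c a),
    J.mul_comm d b, J.mul_comm b a] at h2
  linear_combination (norm := module) h2 - h1

theorem commute_mul_mul_self (x : X) : Commute (J.mul x) (J.mul (J.mul x x)) := by
  refine LinearMap.ext fun d => ?_
  simp only [Module.End.mul_apply]
  rw [J.mul_comm (J.mul x x) d, ← J.jordan x d, J.mul_comm]

theorem mul_one (x : X) : J.mul x J.one = x := by
  rw [J.mul_comm, J.one_mul]

/-- Writing `L` for multiplication, the linearized identity expresses `L(x∘(x∘z))` through `L(x)`,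
`L(x∘x)`, `L(z)` and `L(x∘z)`; hence an induction reaching two steps back. -/
theorem commute_mul_pow (x : X) (n : ℕ) : Commute (J.mul x) (J.mul ((J.mul x ^ n) J.one)) := by
  induction n using Nat.twoStepInduction with
  | zero =>
    have : J.mul J.one = 1 := LinearMap.ext J.one_mul
    simp [this]
  | one => simp [J.mul_one]
  | more n h1 h2 =>
    set z := (J.mul x ^ n) J.one with hz
    have e1 : (J.mul x ^ (n + 1)) J.one = J.mul x z := by rw [pow_succ', Module.End.mul_apply]
    have e2 : (J.mul x ^ (n + 2)) J.one = J.mul x (J.mul x z) := by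
      rw [pow_succ', Module.End.mul_apply, e1]
    rw [e1] at h2
    have e3 : J.mul (J.mul x (J.mul x z)) = J.mul x * J.mul (J.mul x z) + J.mul x * J.mul (J.mul x z)
        + J.mul z * J.mul (J.mul x x) - J.mul x * (J.mul x * J.mul z)
        - J.mul z * (J.mul x * J.mul x) := by
      refine LinearMap.ext fun d => ?_
      rw [J.mul_mul_mul_apply, J.mul_comm z x]
      rfl
    rw [e2, e3]
    have hx := Commute.refl (J.mul x)
    exact ((((hx.mul_right h2).add_right (hx.mul_right h2)).add_right
      (h1.mul_right (J.commute_mul_mul_self x))).sub_right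
      (hx.mul_right (hx.mul_right h1))).sub_right (h1.mul_right (hx.mul_right hx))

/-- Power associativity: `p ↦ p(L(x)) e` is multiplicative. -/
theorem aeval_mul_aeval (x : X) (p q : Polynomial ℝ) :
    J.mul (Polynomial.aeval (J.mul x) p J.one) (Polynomial.aeval (J.mul x) q J.one) =
      Polynomial.aeval (J.mul x) (q * p) J.one := by
  have hc : Commute (J.mul x) (J.mul (Polynomial.aeval (J.mul x) p J.one)) := by
    induction p using Polynomial.induction_on' with
    | add p q hp hq =>
      simp only [map_add, LinearMap.add_apply]
      exact hp.add_right hq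
    | monomial n a =>
      rw [Polynomial.aeval_monomial, ← Algebra.smul_def, LinearMap.smul_apply, map_smul]
      exact (J.commute_mul_pow x n).smul_right a
  have hq : Commute (Polynomial.aeval (J.mul x) q)
      (J.mul (Polynomial.aeval (J.mul x) p J.one)) := by
    induction q using Polynomial.induction_on' with
    | add p q hp hq =>
      rw [map_add]
      exact hp.add_left hq
    | monomial n a =>
      rw [Polynomial.aeval_monomial, ← Algebra.smul_def]
      exact (hc.pow_left n).smul_left a
  rw [← Module.End.mul_apply, ← hq.eq, map_mul, Module.End.mul_apply, Module.End.mul_apply,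
    J.mul_one]

theorem mul_isSymmetric (x : X) : (J.mul x).IsSymmetric := fun y z => J.inner_mul x y z

theorem IsIdem.inner_one {J : EuclideanJordanAlgebra X} {c : X} (hc : J.IsIdem c) :
    ⟪J.one, c⟫ = ‖c‖ ^ 2 := by
  rw [← real_inner_self_eq_norm_sq]
  nth_rw 1 [← hc]
  rw [← J.inner_mul, J.mul_one]

theorem IsIdem.mem_symmCone {J : EuclideanJordanAlgebra X} {c : X} (hc : J.IsIdem c) :
    c ∈ J.symmCone := ⟨c, hc.symm⟩

theorem inner_eq_zero_of_mul_eq_zero {a b : X} (h : J.mul a b = 0) : ⟪a, b⟫ = 0 := by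
  have := J.inner_mul a J.one b
  rwa [J.mul_one, h, inner_zero_right] at this

/-- Multiplication by an idempotent is positive semidefinite. -/
theorem IsIdem.inner_mul_nonneg {J : EuclideanJordanAlgebra X} {c : X} (hc : J.IsIdem c) (z : X) :
    0 ≤ ⟪J.mul c z, z⟫ := by
  have hc' : J.mul c c = c := hc
  -- With `L` the multiplication by `c`, this is `2L³ = 3L² - L`, so only 0, 1/2 and 1 can be
  -- eigenvalues. It yields `⟪Lz, z⟫ = ‖Lz‖² + 4‖Lz - L²z‖²`.
  have h : ∀ d, (2 : ℝ) • J.mul c (J.mul c (J.mul c d)) =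
      (3 : ℝ) • J.mul c (J.mul c d) - J.mul c d := fun d => by
    have := J.mul_mul_mul_apply c c c d
    simp only [hc'] at this
    linear_combination (norm := module) this
  set a := J.mul c z with ha
  set b := J.mul c a with hb
  have h3 : (2 : ℝ) • J.mul c b = (3 : ℝ) • b - a := h z
  have h4 : (2 : ℝ) • J.mul c (J.mul c b) = (3 : ℝ) • J.mul c b - b := h a
  have s1 : ⟪b, z⟫ = ⟪a, a⟫ := J.inner_mul c a z
  have s2 : ⟪J.mul c b, z⟫ = ⟪a, b⟫ := by rw [J.inner_mul, ← ha, real_inner_comm]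
  have s3 : ⟪J.mul c (J.mul c b), z⟫ = ⟪b, b⟫ := by rw [J.inner_mul, ← ha, J.inner_mul]
  have t3 := congrArg (fun w => ⟪w, z⟫) h3
  have t4 := congrArg (fun w => ⟪w, z⟫) h4
  simp only [inner_sub_left, real_inner_smul_left, s1, s2, s3] at t3 t4
  have n1 : 0 ≤ ⟪a, a⟫ := real_inner_self_nonneg
  have n2 : 0 ≤ ⟪a - b, a - b⟫ := real_inner_self_nonneg
  rw [inner_sub_sub_self, real_inner_comm a b] at n2
  linarith

theorem inner_mul_self_nonneg_of_isIdem {c : X} (hc : J.IsIdem c) (z : X) :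
    0 ≤ ⟪c, J.mul z z⟫ := by
  have := hc.inner_mul_nonneg z
  rwa [J.mul_comm, J.inner_mul] at this

end Identities

/-! ### Spectral theorem, self-duality of the cone, compactness of the spectraplex. -/

section Spectral

variable {X : Type*} [NormedAddCommGroup X] [InnerProductSpace ℝ X]
  (J : EuclideanJordanAlgebra X)

/-- A finite family of pairwise orthogonal idempotents. -/
structure IsOrthoIdem (s : Finset ℝ) (c : ℝ → X) : Prop where
  isIdem : ∀ r ∈ s, J.IsIdem (c r)
  mul_eq_zero : ∀ r ∈ s, ∀ r' ∈ s, r ≠ r' → J.mul (c r) (c r') = 0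

variable {J}

theorem IsOrthoIdem.mul_sum {s : Finset ℝ} {c : ℝ → X} (h : J.IsOrthoIdem s c) (f : ℝ → ℝ) :
    J.mul (∑ r ∈ s, f r • c r) (∑ r ∈ s, f r • c r) = ∑ r ∈ s, (f r) ^ 2 • c r := by
  simp only [map_sum, LinearMap.sum_apply, map_smul, LinearMap.smul_apply]
  refine Finset.sum_congr rfl fun r hr => ?_
  rw [Finset.sum_eq_single r]
  · rw [h.isIdem r hr, smul_smul, sq]
  · intro r' hr' hne
    rw [h.mul_eq_zero r' hr' r hr hne, smul_zero]
  · exact fun h => absurd hr h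

theorem IsOrthoIdem.inner_sum {s : Finset ℝ} {c : ℝ → X} (h : J.IsOrthoIdem s c) (f : ℝ → ℝ)
    {r : ℝ} (hr : r ∈ s) : ⟪∑ r ∈ s, f r • c r, c r⟫ = f r * ‖c r‖ ^ 2 := by
  rw [sum_inner, Finset.sum_eq_single r]
  · rw [real_inner_smul_left, real_inner_self_eq_norm_sq]
  · intro r' hr' hne
    rw [real_inner_smul_left, J.inner_eq_zero_of_mul_eq_zero (h.mul_eq_zero r' hr' r hr hne),
      mul_zero]
  · exact fun h => absurd hr h

theorem IsOrthoIdem.inner_one_sum {s : Finset ℝ} {c : ℝ → X} (h : J.IsOrthoIdem s c)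
    (f : ℝ → ℝ) : ⟪J.one, ∑ r ∈ s, f r • c r⟫ = ∑ r ∈ s, f r * ‖c r‖ ^ 2 := by
  rw [_root_.inner_sum]
  refine Finset.sum_congr rfl fun r hr => ?_
  rw [real_inner_smul_right, (h.isIdem r hr).inner_one]

variable (J) [FiniteDimensional ℝ X]

/-- The spectral theorem. -/
theorem exists_spectral_decomposition (x : X) :
    ∃ (s : Finset ℝ) (c : ℝ → X), J.IsOrthoIdem s c ∧ x = ∑ r ∈ s, r • c r := by
  classical
  have hT := J.mul_isSymmetric x
  set b := hT.eigenvectorBasis rfl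
  set ev := hT.eigenvalues rfl
  set s : Finset ℝ := Finset.univ.image ev
  -- Multiplication by `x` is symmetric, hence diagonalizable, so a polynomial in it depends only on
  -- the values at the eigenvalues.
  have key : ∀ p q : Polynomial ℝ, (∀ r ∈ s, p.eval r = q.eval r) →
      Polynomial.aeval (J.mul x) p J.one = Polynomial.aeval (J.mul x) q J.one := by
    intro p q hpq
    congr 1
    refine b.toBasis.ext fun i => ?_
    have hi := hT.hasEigenvector_eigenvectorBasis rfl i
    rw [OrthonormalBasis.coe_toBasis]
    have h1 := Module.End.aeval_apply_of_hasEigenvector (p := p) hi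
    have h2 := Module.End.aeval_apply_of_hasEigenvector (p := q) hi
    have h3 := hpq (ev i) (Finset.mem_image_of_mem _ (Finset.mem_univ i))
    exact h1.trans ((congrArg (· • _) h3).trans h2.symm)
  have hinj : Set.InjOn (id : ℝ → ℝ) s := Function.injective_id.injOn
  have hval : ∀ r ∈ s, ∀ t ∈ s, (Lagrange.basis s id r).eval t = if r = t then 1 else 0 := by
    intro r hr t ht
    split_ifs with h
    · subst h
      exact Lagrange.eval_basis_self hinj hr
    · exact Lagrange.eval_basis_of_ne (v := id) h ht
  -- The idempotents are the Lagrange basis polynomials evaluated at `x`. Some may be zero, which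
  -- later arguments treat separately.
  refine ⟨s, fun r => Polynomial.aeval (J.mul x) (Lagrange.basis s id r) J.one,
    ⟨fun r hr => ?_, fun r hr r' hr' hne => ?_⟩, ?_⟩
  · refine (J.aeval_mul_aeval x _ _).trans (key _ _ fun t ht => ?_)
    rw [Polynomial.eval_mul, hval r hr t ht]
    split_ifs <;> simp
  · refine (J.aeval_mul_aeval x _ _).trans ((key _ 0 fun t ht => ?_).trans (by simp))
    rw [Polynomial.eval_mul, hval r hr t ht, hval r' hr' t ht]
    split_ifs with h1 h2 <;> simp_all
  · have h : Polynomial.aeval (J.mul x) (Polynomial.X : Polynomial ℝ) J.one =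
        Polynomial.aeval (J.mul x) (∑ r ∈ s, r • Lagrange.basis s id r) J.one := by
      refine key _ _ fun t ht => ?_
      rw [Polynomial.eval_X, Polynomial.eval_finsetSum, Finset.sum_eq_single t]
      · rw [Polynomial.eval_smul, hval t ht t ht]; simp
      · intro r hr hne
        rw [Polynomial.eval_smul, hval r hr t ht, if_neg hne, smul_zero]
      · exact fun h => absurd ht h
    rw [Polynomial.aeval_X, J.mul_one] at h
    refine h.trans ?_
    rw [map_sum, LinearMap.sum_apply]
    refine Finset.sum_congr rfl fun r _ => ?_
    rw [map_smul, LinearMap.smul_apply]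

theorem exists_nonneg_decomposition {x : X} (hx : x ∈ J.symmCone) :
    ∃ (s : Finset ℝ) (c : ℝ → X) (f : ℝ → ℝ), J.IsOrthoIdem s c ∧ (∀ r ∈ s, 0 ≤ f r) ∧
      x = ∑ r ∈ s, f r • c r := by
  obtain ⟨w, rfl⟩ := hx
  obtain ⟨s, c, h, hw⟩ := J.exists_spectral_decomposition w
  refine ⟨s, c, fun r => r ^ 2, h, fun r _ => sq_nonneg r, ?_⟩
  have := h.mul_sum (fun r => r)
  rwa [← hw] at this

/-- The symmetric cone is self-dual. -/
theorem mem_symmCone_iff {x : X} : x ∈ J.symmCone ↔ ∀ z, 0 ≤ ⟪x, J.mul z z⟫ := by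
  constructor
  · intro hx z
    obtain ⟨s, c, f, h, hf, rfl⟩ := J.exists_nonneg_decomposition hx
    rw [sum_inner]
    refine Finset.sum_nonneg fun r hr => ?_
    rw [real_inner_smul_left]
    exact mul_nonneg (hf r hr) (J.inner_mul_self_nonneg_of_isIdem (h.isIdem r hr) z)
  · intro hx
    obtain ⟨s, c, h, hxs⟩ := J.exists_spectral_decomposition x
    -- Testing `x` against the square `c r` shows `r ≥ 0` whenever `c r ≠ 0`, so the square root is
    -- genuine where it matters.
    refine ⟨∑ r ∈ s, Real.sqrt r • c r, ?_⟩
    rw [h.mul_sum, hxs]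
    refine Finset.sum_congr rfl fun r hr => ?_
    rcases eq_or_ne (c r) 0 with h0 | h0
    · rw [h0, smul_zero, smul_zero]
    · have h1 := hx (c r)
      rw [h.isIdem r hr, hxs, h.inner_sum (fun r => r) hr] at h1
      rw [Real.sq_sqrt]
      exact nonneg_of_mul_nonneg_left h1 (by positivity)

theorem isClosed_symmCone : IsClosed J.symmCone := by
  have : J.symmCone = ⋂ z, {x | 0 ≤ ⟪x, J.mul z z⟫} := by
    ext x
    simp [J.mem_symmCone_iff]
  rw [this]
  exact isClosed_iInter fun z => isClosed_le continuous_const (by fun_prop)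

theorem add_mem_symmCone {x y : X} (hx : x ∈ J.symmCone) (hy : y ∈ J.symmCone) :
    x + y ∈ J.symmCone := by
  rw [J.mem_symmCone_iff] at *
  intro z
  rw [inner_add_left]
  exact add_nonneg (hx z) (hy z)

theorem smul_mem_symmCone {x : X} (hx : x ∈ J.symmCone) {t : ℝ} (ht : 0 ≤ t) :
    t • x ∈ J.symmCone := by
  rw [J.mem_symmCone_iff] at *
  intro z
  rw [real_inner_smul_left]
  exact mul_nonneg ht (hx z)

theorem convex_spectraplex : Convex ℝ J.spectraplex := by
  rintro x ⟨hx, hx1⟩ y ⟨hy, hy1⟩ a b ha hb hab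
  refine ⟨J.add_mem_symmCone (J.smul_mem_symmCone hx ha) (J.smul_mem_symmCone hy hb), ?_⟩
  rw [inner_add_right, real_inner_smul_right, real_inner_smul_right, hx1, hy1]
  linarith

/-- The product is bounded bilinear, so `‖c‖ = ‖c∘c‖ ≤ M‖c‖²`. The added 1 keeps the constant
invertible. -/
theorem exists_le_norm_of_isIdem : ∃ ε > 0, ∀ c, J.IsIdem c → c ≠ 0 → ε ≤ ‖c‖ := by
  let M : X →L[ℝ] X →L[ℝ] X :=
    LinearMap.toContinuousLinearMap (LinearMap.toContinuousLinearMap.toLinearMap ∘ₗ J.mul)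
  refine ⟨(‖M‖ + 1)⁻¹, by positivity, fun c hc h0 => ?_⟩
  have h1 : ‖J.mul c c‖ ≤ ‖M‖ * ‖c‖ * ‖c‖ := M.le_opNorm₂ c c
  rw [hc] at h1
  have h2 : 0 < ‖c‖ := norm_pos_iff.mpr h0
  have h3 : 1 ≤ ‖M‖ * ‖c‖ := le_of_mul_le_mul_right (by linarith) h2
  rw [inv_le_iff_one_le_mul₀ (by positivity)]
  nlinarith

/-- For `x = ∑ f c` one has `⟪e, x⟫ = ∑ f ‖c‖²`, and `‖c‖ ≤ ‖c‖²/ε` termwise. This bounds the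
spectraplex. -/
theorem exists_norm_le_inner_one : ∃ C, ∀ x ∈ J.symmCone, ‖x‖ ≤ C * ⟪J.one, x⟫ := by
  obtain ⟨ε, hε, h⟩ := J.exists_le_norm_of_isIdem
  refine ⟨ε⁻¹, fun x hx => ?_⟩
  obtain ⟨s, c, f, hc, hf, rfl⟩ := J.exists_nonneg_decomposition hx
  rw [hc.inner_one_sum, Finset.mul_sum]
  refine (norm_sum_le _ _).trans (Finset.sum_le_sum fun r hr => ?_)
  rw [norm_smul, Real.norm_eq_abs, abs_of_nonneg (hf r hr), mul_left_comm]
  refine mul_le_mul_of_nonneg_left ?_ (hf r hr)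
  rcases eq_or_ne (c r) 0 with h0 | h0
  · simp [h0]
  · rw [inv_mul_eq_div, le_div_iff₀ hε, sq]
    exact mul_le_mul_of_nonneg_left (h _ (hc.isIdem r hr) h0) (norm_nonneg _)

theorem isCompact_spectraplex : IsCompact J.spectraplex := by
  obtain ⟨C, hC⟩ := J.exists_norm_le_inner_one
  refine Metric.isCompact_of_isClosed_isBounded ?_ ?_
  · exact J.isClosed_symmCone.inter (isClosed_eq (by fun_prop) continuous_const)
  · refine isBounded_iff_forall_norm_le.mpr ⟨C, fun x hx => ?_⟩
    have := hC x hx.1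
    rwa [hx.2, _root_.mul_one] at this

/-- A linear functional that is nonnegative on the spectraplex is nonnegative on the cone. -/
theorem nonneg_of_nonneg_on_spectraplex (f : X →ₗ[ℝ] ℝ) (hf : ∀ x ∈ J.spectraplex, 0 ≤ f x)
    {x : X} (hx : x ∈ J.symmCone) : 0 ≤ f x := by
  obtain ⟨C, hC⟩ := J.exists_norm_le_inner_one
  have h1 : 0 ≤ ⟪J.one, x⟫ := by
    have := J.mem_symmCone_iff.mp hx J.one
    rwa [J.one_mul, real_inner_comm] at this
  rcases h1.eq_or_lt with h0 | h0
  · have := hC x hx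
    rw [← h0, mul_zero, norm_le_zero_iff] at this
    simp [this]
  · have := hf (⟪J.one, x⟫⁻¹ • x) ⟨J.smul_mem_symmCone hx (by positivity), by
      rw [real_inner_smul_right, inv_mul_cancel₀ h0.ne']⟩
    rw [map_smul, smul_eq_mul] at this
    exact nonneg_of_mul_nonneg_right this (by positivity)

end Spectral

end EuclideanJordanAlgebra

/-! ### Nonvanishing of `G` on the cone. -/

namespace IsLISC

variable {V X : Type*} [NormedAddCommGroup V] [InnerProductSpace ℝ V]
  [NormedAddCommGroup X] [InnerProductSpace ℝ X]
  {P : ProperCone ℝ V} {J : EuclideanJordanAlgebra X} {G : X →ₗ[ℝ] V}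

theorem map_mem (hP : IsLISC P J G) {x : X} (hx : x ∈ J.symmCone) : G x ∈ P := by
  have : G x ∈ (P : Set V) := hP.image_eq ▸ Set.mem_image_of_mem G hx
  exact this

theorem eq_zero_of_add_eq_zero (hP : IsLISC P J G) {u v : V} (hu : u ∈ P) (hv : v ∈ P)
    (h : u + v = 0) : u = 0 := by
  have : u ∈ (P : Set V) ∩ {u : V | -u ∈ P} :=
    ⟨hu, by rwa [Set.mem_ofPred_eq, neg_eq_of_add_eq_zero_right h]⟩
  rwa [hP.pointed] at this

variable [FiniteDimensional ℝ X]

/-- If `c = a + b` splits and `G c = 0`, pointedness forces `G a = 0`. Pairing with the unit gives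
`‖c‖² = ‖a‖² + ‖b‖²`, so each splitting costs at least `ε²` and the descent ends at a primitive
idempotent. -/
theorem map_ne_zero_of_isIdem (hP : IsLISC P J G) {c : X} (hc : J.IsIdem c) (h0 : c ≠ 0) :
    G c ≠ 0 := by
  obtain ⟨ε, hε, hnorm⟩ := J.exists_le_norm_of_isIdem
  suffices H : ∀ (n : ℕ) (c : X), J.IsIdem c → c ≠ 0 → ‖c‖ ^ 2 ≤ n * ε ^ 2 → G c ≠ 0 by
    obtain ⟨n, hn⟩ := exists_nat_ge (‖c‖ ^ 2 / ε ^ 2)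
    exact H n c hc h0 ((div_le_iff₀ (by positivity)).mp hn)
  intro n
  induction n with
  | zero =>
    intro c _ h0 hn
    have : 0 < ‖c‖ := norm_pos_iff.mpr h0
    have : 0 < ‖c‖ ^ 2 := by positivity
    simp at hn
    exact absurd hn h0
  | succ n ih =>
    intro c hc h0 hn hG
    by_cases hprim : J.IsPrimitiveIdem c
    · exact hP.map_ne_zero c hprim hG
    · have : ∃ a b : X, J.IsIdem a ∧ J.IsIdem b ∧ a ≠ 0 ∧ b ≠ 0 ∧ c = a + b := by
        by_contra h
        exact hprim ⟨hc, h0, h⟩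
      obtain ⟨a, b, ha, hb, ha0, hb0, rfl⟩ := this
      have e1 := hc.inner_one
      rw [inner_add_right, ha.inner_one, hb.inner_one] at e1
      refine ih a ha ha0 ?_ (hP.eq_zero_of_add_eq_zero (hP.map_mem ha.mem_symmCone)
        (hP.map_mem hb.mem_symmCone) (by rw [← map_add, hG]))
      have := pow_le_pow_left₀ hε.le (hnorm b hb hb0) 2
      push_cast at hn
      linarith

/-- `G` has no nonzero kernel element in the symmetric cone. -/
theorem map_ne_zero_of_mem (hP : IsLISC P J G) {x : X} (hx : x ∈ J.symmCone) (h0 : x ≠ 0) :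
    G x ≠ 0 := by
  intro hG
  apply h0
  obtain ⟨s, c, f, hc, hf, rfl⟩ := J.exists_nonneg_decomposition hx
  refine Finset.sum_eq_zero fun r hr => ?_
  have hmem : ∀ r ∈ s, f r • c r ∈ J.symmCone := fun r hr =>
    J.smul_mem_symmCone (hc.isIdem r hr).mem_symmCone (hf r hr)
  have h1 : G (f r • c r) = 0 := by
    refine hP.eq_zero_of_add_eq_zero (v := ∑ t ∈ s.erase r, G (f t • c t))
      (hP.map_mem (hmem r hr)) ?_ ?_
    · exact Submodule.sum_mem _ fun t ht => hP.map_mem (hmem t (Finset.mem_of_mem_erase ht))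
    · rw [Finset.add_sum_erase _ (fun t => G (f t • c t)) hr, ← map_sum, hG]
  rcases eq_or_ne (c r) 0 with h2 | h2
  · rw [h2, smul_zero]
  · rw [map_smul, smul_eq_zero] at h1
    rw [h1.resolve_right (hP.map_ne_zero_of_isIdem (hc.isIdem r hr) h2), zero_smul]

theorem map_ne_zero_of_mem_spectraplex (hP : IsLISC P J G) {x : X} (hx : x ∈ J.spectraplex) :
    G x ≠ 0 := by
  refine hP.map_ne_zero_of_mem hx.1 ?_
  rintro rfl
  simpa using hx.2

end IsLISC

/-! ### Derivatives of the fractional objective. -/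

section Objective

variable {V X Y : Type*} [NormedAddCommGroup V] [InnerProductSpace ℝ V]
  [NormedAddCommGroup X] [InnerProductSpace ℝ X]
  [NormedAddCommGroup Y] [InnerProductSpace ℝ Y]
  (G : X →ₗ[ℝ] V) (H : Y →ₗ[ℝ] V)

theorem fracObj_swap (x : X) (y : Y) : fracObj H G (y, x) = fracObj G H (x, y) := by
  simp only [fracObj]
  rw [real_inner_comm, mul_comm]

/-- Exchanging the blocks lets every statement about `linX` serve for `linY`. -/
theorem linY_eq_linX (x : X) (y : Y) : linY G H x y = linX H G y x := by
  funext z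
  rw [linY, linX, fracObj_swap, mul_right_comm]

theorem neg_one_le_fracObj (p : X × Y) : -1 ≤ fracObj G H p :=
  (abs_le.mp (abs_real_inner_div_norm_mul_norm_le_one (G p.1) (H p.2))).1

theorem linX_add (xk : X) (yk : Y) (a b : X) :
    linX G H xk yk (a + b) = linX G H xk yk a + linX G H xk yk b := by
  simp only [linX, map_add, inner_add_left]

theorem linX_smul (xk : X) (yk : Y) (t : ℝ) (a : X) :
    linX G H xk yk (t • a) = t * linX G H xk yk a := by
  simp only [linX, map_smul, real_inner_smul_left]

/-- The partial linearization as a linear functional. -/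
noncomputable def linXLinear (xk : X) (yk : Y) : X →ₗ[ℝ] ℝ where
  toFun := linX G H xk yk
  map_add' := linX_add G H xk yk
  map_smul' := linX_smul G H xk yk

theorem linX_sub (xk : X) (yk : Y) (a b : X) :
    linX G H xk yk (a - b) = linX G H xk yk a - linX G H xk yk b :=
  map_sub (linXLinear G H xk yk) a b

theorem linX_zero (xk : X) (yk : Y) : linX G H xk yk 0 = 0 :=
  map_zero (linXLinear G H xk yk)

variable {G H}

theorem linX_self {xk : X} {yk : Y} (hx : G xk ≠ 0) (hy : H yk ≠ 0) :
    linX G H xk yk xk = 0 := by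
  have h1 : ‖G xk‖ ≠ 0 := norm_ne_zero_iff.mpr hx
  have h2 : ‖H yk‖ ≠ 0 := norm_ne_zero_iff.mpr hy
  simp only [linX, fracObj, inner_sub_right, real_inner_smul_right, real_inner_self_eq_norm_sq]
  field_simp
  ring

/-- Identifies the slope in the Armijo test with the true directional derivative. -/
theorem hasDerivAt_fracObj_line {x : X} {y : Y} (hx : G x ≠ 0) (hy : H y ≠ 0) (d₁ : X) (d₂ : Y) :
    HasDerivAt (fun t : ℝ => fracObj G H (x + t • d₁, y + t • d₂))
      ((linX G H x y d₁ + linY G H x y d₂) / (‖G x‖ * ‖H y‖)) 0 := by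
  have h1 : ‖G x‖ ≠ 0 := norm_ne_zero_iff.mpr hx
  have h2 : ‖H y‖ ≠ 0 := norm_ne_zero_iff.mpr hy
  have line : ∀ a d : V, HasDerivAt (fun t : ℝ => a + t • d) d 0 := fun a d => by
    simpa using ((hasDerivAt_id (0 : ℝ)).smul_const d).const_add a
  have nrm : ∀ a d : V, a ≠ 0 → HasDerivAt (fun t : ℝ => ‖a + t • d‖) (⟪a, d⟫ / ‖a‖) 0 := by
    intro a d ha
    have ha' : ‖a‖ ≠ 0 := norm_ne_zero_iff.mpr ha
    have h := (((line a d).norm_sq).sqrt (by simpa using ha))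
    simp only [Real.sqrt_sq (norm_nonneg _), zero_smul, add_zero] at h
    convert h using 1
    field_simp
  have hd := ((line (G x) (G d₁)).inner ℝ (line (H y) (H d₂))).div
    ((nrm _ (G d₁) hx).mul (nrm _ (H d₂) hy)) (by simpa using ⟨hx, hy⟩)
  simp only [zero_smul, add_zero, Pi.mul_apply] at hd
  refine (hd.congr_of_eventuallyEq (Eventually.of_forall fun t => ?_)).congr_deriv ?_
  · simp [fracObj]
  · simp only [linX, linY, fracObj, inner_sub_right, real_inner_smul_right]
    rw [real_inner_comm (G x) (G d₁), real_inner_comm (H y) (H d₂), real_inner_comm (G x) (H d₂)]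
    field_simp
    ring

variable [FiniteDimensional ℝ X] [FiniteDimensional ℝ Y]

theorem contDiffAt_fracObj {x : X} {y : Y} (hx : G x ≠ 0) (hy : H y ≠ 0) :
    ContDiffAt ℝ 1 (fracObj G H) (x, y) := by
  have hG : ContDiffAt ℝ 1 (fun p : X × Y => G p.1) (x, y) :=
    (LinearMap.toContinuousLinearMap G).contDiff.contDiffAt.comp _ contDiffAt_fst
  have hH : ContDiffAt ℝ 1 (fun p : X × Y => H p.2) (x, y) :=
    (LinearMap.toContinuousLinearMap H).contDiff.contDiffAt.comp _ contDiffAt_snd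
  exact (hG.inner ℝ hH).div ((hG.norm ℝ hx).mul (hH.norm ℝ hy))
    (mul_ne_zero (norm_ne_zero_iff.mpr hx) (norm_ne_zero_iff.mpr hy))

theorem fderiv_fracObj {x : X} {y : Y} (hx : G x ≠ 0) (hy : H y ≠ 0) (d₁ : X) (d₂ : Y) :
    fderiv ℝ (fracObj G H) (x, y) (d₁, d₂) =
      (linX G H x y d₁ + linY G H x y d₂) / (‖G x‖ * ‖H y‖) := by
  have h := ((contDiffAt_fracObj hx hy).differentiableAt one_ne_zero).hasFDerivAt
  have line : HasDerivAt (fun t : ℝ => (x, y) + t • (d₁, d₂)) (d₁, d₂) 0 := by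
    simpa using ((hasDerivAt_id (0 : ℝ)).smul_const (d₁, d₂)).const_add (x, y)
  have hc := HasFDerivAt.comp_hasDerivAt (0 : ℝ)
    (f := fun t : ℝ => (x, y) + t • (d₁, d₂)) (by simpa using h) line
  exact hc.unique (hasDerivAt_fracObj_line hx hy d₁ d₂)

theorem inner_grad {E : Type*} [NormedAddCommGroup E] [InnerProductSpace ℝ E]
    [FiniteDimensional ℝ E] (f : E → ℝ) (x d : E) : ⟪grad f x, d⟫ = fderiv ℝ f x d := by
  have : CompleteSpace E := FiniteDimensional.complete ℝ E
  exact InnerProductSpace.toDual_symm_apply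

theorem inner_grad_fracObj_left {x : X} {y : Y} (hx : G x ≠ 0) (hy : H y ≠ 0) (d : X) :
    ⟪grad (fun x' => fracObj G H (x', y)) x, d⟫ = linX G H x y d / (‖G x‖ * ‖H y‖) := by
  have h := ((contDiffAt_fracObj hx hy).differentiableAt one_ne_zero).hasFDerivAt
  have hc : HasFDerivAt (fun x' => fracObj G H (x', y)) _ x :=
    HasFDerivAt.comp (g := fracObj G H) (f := fun x' => (x', y)) x h (hasFDerivAt_prodMk_left x y)
  rw [inner_grad, hc.fderiv]
  have := fderiv_fracObj hx hy d 0
  rw [linY_eq_linX, linX_zero, add_zero] at this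
  simpa using this

theorem continuousAt_linX {xb : X} {yb : Y} (hx : G xb ≠ 0) (hy : H yb ≠ 0) (d : X) :
    ContinuousAt (fun p : X × Y × X => linX G H p.1 p.2.1 p.2.2) (xb, yb, d) := by
  have cG : Continuous G := G.continuous_of_finiteDimensional
  have cH : Continuous H := H.continuous_of_finiteDimensional
  have hf : ContinuousAt (fun p : X × Y × X => fracObj G H (p.1, p.2.1)) (xb, yb, d) :=
    ContinuousAt.comp (g := fracObj G H) (f := fun p : X × Y × X => (p.1, p.2.1))
      (contDiffAt_fracObj hx hy).continuousAt (by fun_prop)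
  have h1 : ContinuousAt (fun p : X × Y × X => ‖G p.1‖⁻¹) (xb, yb, d) :=
    ContinuousAt.inv₀ (by fun_prop) (norm_ne_zero_iff.mpr hx)
  unfold linX
  fun_prop

end Objective

/-! ### Line search and subproblem limits. -/

section Convergence

variable {V X Y : Type*} [NormedAddCommGroup V] [InnerProductSpace ℝ V]
  [NormedAddCommGroup X] [InnerProductSpace ℝ X]
  [NormedAddCommGroup Y] [InnerProductSpace ℝ Y]
  {G : X →ₗ[ℝ] V} {H : Y →ₗ[ℝ] V}

/-- If step lengths tending to zero violate the sufficient decrease condition along convergent base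
points and directions, then the limiting directional derivative is at least `α` times itself. -/
theorem mul_fderiv_le_of_violated_decrease {E ι : Type*} [NormedAddCommGroup E] [NormedSpace ℝ E]
    {f : E → ℝ} {l : Filter ι} [l.NeBot] {z d : ι → E} {z₀ d₀ : E} {s D : ι → ℝ} {α D₀ : ℝ}
    (hf : ContDiffAt ℝ 1 f z₀) (hz : Tendsto z l (𝓝 z₀)) (hd : Tendsto d l (𝓝 d₀))
    (hs : Tendsto s l (𝓝 0)) (hs0 : ∀ᶠ k in l, 0 < s k) (hD : Tendsto D l (𝓝 D₀))
    (h : ∀ᶠ k in l, f (z k) + α * s k * D k < f (z k + s k • d k)) :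
    α * D₀ ≤ fderiv ℝ f z₀ d₀ := by
  -- Strict differentiability is needed because the base points `z k` move as well.
  have hst := (hf.hasStrictFDerivAt one_ne_zero).isLittleO
  have hsd : Tendsto (fun k => s k • d k) l (𝓝 0) := by simpa using hs.smul hd
  have hzz : Tendsto (fun k => (z k + s k • d k, z k)) l (𝓝 (z₀, z₀)) := by
    have := (hz.add hsd).prodMk_nhds hz
    rwa [add_zero] at this
  have ho := hst.comp_tendsto hzz
  simp only [Function.comp_def, add_sub_cancel_left] at ho
  have ho2 : (fun k => f (z k + s k • d k) - f (z k) - fderiv ℝ f z₀ (s k • d k)) =o[l] s := by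
    refine ho.trans_isBigO ?_
    have := (Asymptotics.isBigO_refl s l).smul (hd.isBigO_one ℝ)
    simpa using this
  have hq := ho2.tendsto_div_nhds_zero
  have hlim : Tendsto (fun k => (f (z k + s k • d k) - f (z k) - fderiv ℝ f z₀ (s k • d k)) / s k
      + fderiv ℝ f z₀ (d k)) l (𝓝 (fderiv ℝ f z₀ d₀)) := by
    have := hq.add (((fderiv ℝ f z₀).continuous.tendsto d₀).comp hd)
    rwa [zero_add] at this
  refine le_of_tendsto_of_tendsto (hD.const_mul α) hlim ?_
  filter_upwards [h, hs0] with k hk hk0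
  rw [map_smul, smul_eq_mul, sub_div, mul_div_cancel_left₀ _ hk0.ne', sub_add_cancel,
    le_div_iff₀ hk0]
  linarith

/-- If a minimizer of the regularized partial linearization does not decrease the linearization,
then the linearization is nonnegative on the spectraplex. -/
theorem linX_nonneg_of_isSolution [FiniteDimensional ℝ X] {J : EuclideanJordanAlgebra X} {μ : ℝ} {x xt : X} {y : Y}
    (hμ : 0 ≤ μ) (hx : x ∈ J.spectraplex) (hGx : G x ≠ 0) (hHy : H y ≠ 0)
    (hsol : IsSolution (fun z => linX G H x y z + μ / 2 * ‖z - x‖ ^ 2) J.spectraplex xt)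
    (h0 : 0 ≤ linX G H x y xt) {z : X} (hz : z ∈ J.spectraplex) : 0 ≤ linX G H x y z := by
  have hself := linX_self hGx hHy
  have hall : ∀ w ∈ J.spectraplex, 0 ≤ linX G H x y w + μ / 2 * ‖w - x‖ ^ 2 := fun w hw =>
    (add_nonneg h0 (by positivity)).trans (hsol.2 w hw)
  by_contra! hneg
  have hcont : Tendsto (fun s : ℝ => linX G H x y z + s * (μ / 2 * ‖z - x‖ ^ 2)) (𝓝[>] 0)
      (𝓝 (linX G H x y z + 0 * (μ / 2 * ‖z - x‖ ^ 2))) :=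
    Tendsto.mono_left (Continuous.tendsto (by fun_prop) 0) nhdsWithin_le_nhds
  rw [zero_mul, add_zero] at hcont
  refine absurd (ge_of_tendsto hcont ?_) hneg.not_ge
  filter_upwards [Ioo_mem_nhdsGT (zero_lt_one' ℝ)] with s hs
  -- Along the segment the linear part scales as `s` and the regularization as `s²`; dividing by `s`
  -- and letting `s → 0` removes the latter.
  have h1 := hall (x + s • (z - x))
    (J.convex_spectraplex.add_smul_sub_mem hx hz ⟨hs.1.le, hs.2.le⟩)
  rw [linX_add, linX_smul, linX_sub, hself, add_sub_cancel_left, norm_smul, Real.norm_eq_abs,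
    abs_of_pos hs.1] at h1
  refine nonneg_of_mul_nonneg_right (a := s) ?_ hs.1
  linarith

/-- The current point competes in its own subproblem, with zero regularization term. -/
theorem linX_sub_nonpos_of_isSolution {J : EuclideanJordanAlgebra X} {μ : ℝ} {x xt : X} {y : Y}
    (hμ : 0 ≤ μ) (hx : x ∈ J.spectraplex)
    (hsol : IsSolution (fun z => linX G H x y z + μ / 2 * ‖z - x‖ ^ 2) J.spectraplex xt) :
    linX G H x y (xt - x) ≤ 0 := by
  have h := hsol.2 x hx
  simp only [sub_self, norm_zero] at h
  have : 0 ≤ μ / 2 * ‖xt - x‖ ^ 2 := by positivity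
  rw [linX_sub]
  linarith

/-- Minimizers of the regularized partial linearizations pass to the limit. -/
theorem isSolution_of_tendsto [FiniteDimensional ℝ X] [FiniteDimensional ℝ Y]
    {J : EuclideanJordanAlgebra X} {ι : Type*} {l : Filter ι} [l.NeBot]
    {μ : ℝ} {x xt : ι → X} {y : ι → Y} {xb xtb : X} {yb : Y} (hGx : G xb ≠ 0) (hHy : H yb ≠ 0)
    (hx : Tendsto x l (𝓝 xb)) (hy : Tendsto y l (𝓝 yb)) (hxt : Tendsto xt l (𝓝 xtb))
    (hsol : ∀ k, IsSolution (fun z => linX G H (x k) (y k) z + μ / 2 * ‖z - x k‖ ^ 2)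
      J.spectraplex (xt k)) :
    IsSolution (fun z => linX G H xb yb z + μ / 2 * ‖z - xb‖ ^ 2) J.spectraplex xtb := by
  have lim : ∀ (w : ι → X) (w₀ : X), Tendsto w l (𝓝 w₀) →
      Tendsto (fun k => linX G H (x k) (y k) (w k) + μ / 2 * ‖w k - x k‖ ^ 2) l
        (𝓝 (linX G H xb yb w₀ + μ / 2 * ‖w₀ - xb‖ ^ 2)) := fun w w₀ hw =>
    ((continuousAt_linX hGx hHy w₀).tendsto.comp
      (hx.prodMk_nhds (hy.prodMk_nhds hw))).add ((((hw.sub hx).norm).pow 2).const_mul _)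
  refine ⟨J.isCompact_spectraplex.isClosed.mem_of_tendsto hxt
    (Eventually.of_forall fun k => (hsol k).1), fun w hw => ?_⟩
  exact le_of_tendsto_of_tendsto (lim xt xtb hxt) (lim _ w tendsto_const_nhds)
    (Eventually.of_forall fun k => (hsol k).2 w hw)

/-- First-order optimality of one block from nonnegativity of the partial linearization. -/
theorem complementarity_of_linX_nonneg [FiniteDimensional ℝ X] [FiniteDimensional ℝ Y]
    {J : EuclideanJordanAlgebra X} {x : X} {y : Y}
    (hx : x ∈ J.spectraplex) (hGx : G x ≠ 0) (hHy : H y ≠ 0)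
    (h : ∀ z ∈ J.spectraplex, 0 ≤ linX G H x y z) (w : X) :
    x ∈ J.symmCone ∧ ⟪x, grad (fun x' => fracObj G H (x', y)) x + (0 : ℝ) • w⟫ = 0 ∧
      grad (fun x' => fracObj G H (x', y)) x + (0 : ℝ) • w ∈ dualCone J.symmCone := by
  -- The multiplier can be 0: homogeneity of degree 0 already makes the gradient orthogonal to `x`.
  rw [zero_smul, add_zero]
  refine ⟨hx.1, ?_, fun z hz => ?_⟩
  · rw [real_inner_comm, inner_grad_fracObj_left hGx hHy, linX_self hGx hHy, zero_div]
  · rw [inner_grad_fracObj_left hGx hHy]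
    exact div_nonneg (J.nonneg_of_nonneg_on_spectraplex (linXLinear G H x y) h hz) (by positivity)

/-- One half of the critical pair conditions from nonnegativity of the partial linearization. -/
theorem sub_mem_dualCone_of_linX_nonneg [FiniteDimensional ℝ X] {J : EuclideanJordanAlgebra X} {P : ProperCone ℝ V}
    (hP : IsLISC P J G) {x : X} {y : Y} (hGx : G x ≠ 0) (hHy : H y ≠ 0)
    (h : ∀ z ∈ J.spectraplex, 0 ≤ linX G H x y z) :
    ‖H y‖⁻¹ • H y - ⟪‖G x‖⁻¹ • G x, ‖H y‖⁻¹ • H y⟫ • (‖G x‖⁻¹ • G x) ∈ dualCone (P : Set V) := by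
  have h1 : ‖G x‖ ≠ 0 := norm_ne_zero_iff.mpr hGx
  have h2 : ‖H y‖ ≠ 0 := norm_ne_zero_iff.mpr hHy
  rw [← hP.image_eq]
  rintro _ ⟨z, hz, rfl⟩
  have h3 := J.nonneg_of_nonneg_on_spectraplex (linXLinear G H x y) h hz
  have h4 : ⟪‖H y‖⁻¹ • H y - ⟪‖G x‖⁻¹ • G x, ‖H y‖⁻¹ • H y⟫ • (‖G x‖⁻¹ • G x), G z⟫ =
      ‖H y‖⁻¹ * linX G H x y z := by
    simp only [linX, fracObj, inner_sub_left, inner_sub_right, real_inner_smul_left,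
      real_inner_smul_right]
    rw [real_inner_comm (H y) (G z), real_inner_comm (G x) (G z)]
    field_simp
  rw [h4]
  exact mul_nonneg (by positivity) h3

theorem differentiableAt_inner_sub_const {E : Type*} [NormedAddCommGroup E]
    [InnerProductSpace ℝ E] (e x : E) : DifferentiableAt ℝ (fun x' => ⟪e, x'⟫ - 1) x :=
  ((innerSL ℝ e).differentiableAt).sub_const 1

namespace IsSRPLRun

variable {JX : EuclideanJordanAlgebra X} {JY : EuclideanJordanAlgebra Y}
  {β α ρ μ₁ μ₂ : ℝ} {x xt : ℕ → X} {y yt : ℕ → Y}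

theorem mem_spectraplex [FiniteDimensional ℝ X] [FiniteDimensional ℝ Y]
    (hrun : IsSRPLRun JX JY G H β α ρ μ₁ μ₂ x xt y yt) (hβ : 0 < β)
    (hρ₀ : 0 < ρ) (hρ₁ : ρ < 1)
    (hfeas : 1 < β → ∀ k, x k ∈ JX.spectraplex ∧ y k ∈ JY.spectraplex) (k : ℕ) :
    x k ∈ JX.spectraplex ∧ y k ∈ JY.spectraplex := by
  rcases lt_or_ge 1 β with h1 | h1
  · exact hfeas h1 k
  induction k with
  | zero => exact ⟨hrun.init_x, hrun.init_y⟩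
  | succ k ih =>
    by_cases hh : linX G H (x k) (y k) (xt k - x k) = 0 ∧ linY G H (x k) (y k) (yt k - y k) = 0
    · obtain ⟨hx, hy⟩ := hrun.halt k hh.1 hh.2
      rwa [hx, hy]
    · obtain ⟨l, -, hx, hy⟩ := hrun.step k hh
      have ht : β * ρ ^ l ∈ Set.Icc (0 : ℝ) 1 :=
        ⟨by positivity, mul_le_one₀ h1 (by positivity) (pow_le_one₀ hρ₀.le hρ₁.le)⟩
      rw [hx, hy]
      exact ⟨JX.convex_spectraplex.add_smul_sub_mem ih.1 (hrun.sub_x k).1 ht,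
        JY.convex_spectraplex.add_smul_sub_mem ih.2 (hrun.sub_y k).1 ht⟩

/-- The step taken at an iterate with negative directional derivative: it decreases the objective
sufficiently, and it is the maximal step `β` or the next larger trial step fails. -/
theorem exists_step (hrun : IsSRPLRun JX JY G H β α ρ μ₁ μ₂ x xt y yt) (hβ : 0 < β) (hρ₀ : 0 < ρ)
    (k : ℕ)
    (hk : ¬ (linX G H (x k) (y k) (xt k - x k) = 0 ∧ linY G H (x k) (y k) (yt k - y k) = 0)) :
    ∃ t : ℝ, 0 < t ∧
      fracObj G H (x (k + 1), y (k + 1)) ≤ fracObj G H (x k, y k) + α * t *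
        ((linX G H (x k) (y k) (xt k - x k) + linY G H (x k) (y k) (yt k - y k)) /
          (‖G (x k)‖ * ‖H (y k)‖)) ∧
      (t < β → ¬ Armijo G H α (x k) (y k) (xt k - x k) (yt k - y k) (t / ρ)) := by
  obtain ⟨l, hl, hx, hy⟩ := hrun.step k hk
  refine ⟨β * ρ ^ l, by positivity, ?_, fun hlt hA => ?_⟩
  · rw [hx, hy]
    exact hl.1
  · cases l with
    | zero => simp at hlt
    | succ n =>
      rw [pow_succ, ← mul_assoc, mul_div_cancel_right₀ _ hρ₀.ne'] at hA
      exact absurd (hl.2 hA) (by simp)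

end IsSRPLRun

end Convergence

/-! ### The convergence theorem. -/

theorem theorem4p6 {V X Y : Type*}
    [NormedAddCommGroup V] [InnerProductSpace ℝ V] [FiniteDimensional ℝ V]
    [NormedAddCommGroup X] [InnerProductSpace ℝ X] [FiniteDimensional ℝ X]
    [NormedAddCommGroup Y] [InnerProductSpace ℝ Y] [FiniteDimensional ℝ Y]
    (JX : EuclideanJordanAlgebra X) (JY : EuclideanJordanAlgebra Y)
    (G : X →ₗ[ℝ] V) (H : Y →ₗ[ℝ] V) (P Q : ProperCone ℝ V)
    (hP : IsLISC P JX G) (hQ : IsLISC Q JY H)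
    (β α ρ μ₁ μ₂ : ℝ) (hβ : 0 < β) (hα₀ : 0 < α) (hα₁ : α < 1) (hρ₀ : 0 < ρ) (hρ₁ : ρ < 1)
    (hμ₁ : 0 ≤ μ₁) (hμ₂ : 0 ≤ μ₂)
    (x xt : ℕ → X) (y yt : ℕ → Y)
    (hrun : IsSRPLRun JX JY G H β α ρ μ₁ μ₂ x xt y yt)
    (hfeas : 1 < β → ∀ k, x k ∈ JX.spectraplex ∧ y k ∈ JY.spectraplex) :
    (∃ p : X × Y, MapClusterPt p atTop (fun k => (x k, y k))) ∧
    ∀ (xbar : X) (ybar : Y), MapClusterPt (xbar, ybar) atTop (fun k => (x k, y k)) →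
      IsFracStationary JX JY G H xbar ybar ∧
      IsCriticalPair P Q (‖G xbar‖⁻¹ • G xbar) (‖H ybar‖⁻¹ • H ybar) := by
  have hmem := hrun.mem_spectraplex hβ hρ₀ hρ₁ hfeas
  have hcomp := JX.isCompact_spectraplex.prod JY.isCompact_spectraplex
  have hsolY : ∀ k, IsSolution (fun z => linX H G (y k) (x k) z + μ₂ / 2 * ‖z - y k‖ ^ 2)
      JY.spectraplex (yt k) := fun k => by
    have := hrun.sub_y k
    rwa [linY_eq_linX] at this
  refine ⟨?_, fun xb yb hcl => ?_⟩
  · obtain ⟨p, -, hp⟩ := hcomp.exists_mapClusterPt (f := atTop) (u := fun k => (x k, y k))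
      (tendsto_principal.mpr (Eventually.of_forall hmem))
    exact ⟨p, hp⟩
  -- Along an ultrafilter the subproblem solutions converge too, by compactness, with no successive
  -- extraction of subsequences.
  obtain ⟨U, hU, hlim⟩ := mapClusterPt_iff_ultrafilter.mp hcl
  have hx : Tendsto x U (𝓝 xb) := (continuous_fst.tendsto _).comp hlim
  have hy : Tendsto y U (𝓝 yb) := (continuous_snd.tendsto _).comp hlim
  have hxb : xb ∈ JX.spectraplex :=
    JX.isCompact_spectraplex.isClosed.mem_of_tendsto hx (Eventually.of_forall fun k => (hmem k).1)
  have hyb : yb ∈ JY.spectraplex :=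
    JY.isCompact_spectraplex.isClosed.mem_of_tendsto hy (Eventually.of_forall fun k => (hmem k).2)
  have hGb := hP.map_ne_zero_of_mem_spectraplex hxb
  have hHb := hQ.map_ne_zero_of_mem_spectraplex hyb
  obtain ⟨xtb, -, hxt⟩ : ∃ a ∈ JX.spectraplex, Tendsto xt U (𝓝 a) :=
    JX.isCompact_spectraplex.ultrafilter_le_nhds' (U.map xt)
      (Ultrafilter.mem_map.mpr (univ_mem' fun k => (hrun.sub_x k).1))
  obtain ⟨ytb, -, hyt⟩ : ∃ a ∈ JY.spectraplex, Tendsto yt U (𝓝 a) :=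
    JY.isCompact_spectraplex.ultrafilter_le_nhds' (U.map yt)
      (Ultrafilter.mem_map.mpr (univ_mem' fun k => (hrun.sub_y k).1))
  have hsx := isSolution_of_tendsto hGb hHb hx hy hxt hrun.sub_x
  have hsy := isSolution_of_tendsto hHb hGb hy hx hyt hsolY
  set D : ℕ → ℝ := fun k =>
    (linX G H (x k) (y k) (xt k - x k) + linY G H (x k) (y k) (yt k - y k)) /
      (‖G (x k)‖ * ‖H (y k)‖) with hD
  have hDnonpos : ∀ k, D k ≤ 0 := fun k => by
    refine div_nonpos_of_nonpos_of_nonneg (add_nonpos ?_ ?_) (by positivity)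
    · exact linX_sub_nonpos_of_isSolution hμ₁ (hmem k).1 (hrun.sub_x k)
    · rw [linY_eq_linX]
      exact linX_sub_nonpos_of_isSolution hμ₂ (hmem k).2 (hsolY k)
  have hDlim : Tendsto D U (𝓝 ((linX G H xb yb (xtb - xb) + linY G H xb yb (ytb - yb)) /
      (‖G xb‖ * ‖H yb‖))) := by
    refine Tendsto.div (Tendsto.add ?_ ?_) (Tendsto.mul ?_ ?_)
      (mul_ne_zero (norm_ne_zero_iff.mpr hGb) (norm_ne_zero_iff.mpr hHb))
    · exact (continuousAt_linX hGb hHb _).tendsto.comp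
        (hx.prodMk_nhds (hy.prodMk_nhds (hxt.sub hx)))
    · simp only [linY_eq_linX]
      exact (continuousAt_linX hHb hGb _).tendsto.comp
        (hy.prodMk_nhds (hx.prodMk_nhds (hyt.sub hy)))
    · exact ((G.continuous_of_finiteDimensional.tendsto xb).comp hx).norm
    · exact ((H.continuous_of_finiteDimensional.tendsto yb).comp hy).norm
  set D₀ := (linX G H xb yb (xtb - xb) + linY G H xb yb (ytb - yb)) / (‖G xb‖ * ‖H yb‖) with hD₀
  set φ : ℕ → ℝ := fun k => fracObj G H (x k, y k)
  -- Stating the conclusion under `D k < 0` allows a dummy step 0 at terminated iterates, where `D k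
  -- = 0`.
  have hstep : ∀ k, ∃ t : ℝ, D k < 0 → 0 < t ∧ φ (k + 1) ≤ φ k + α * t * D k ∧
      (t < β → ¬ Armijo G H α (x k) (y k) (xt k - x k) (yt k - y k) (t / ρ)) := fun k => by
    by_cases hk : linX G H (x k) (y k) (xt k - x k) = 0 ∧ linY G H (x k) (y k) (yt k - y k) = 0
    · exact ⟨0, fun h => absurd h (by simp [hD, hk.1, hk.2])⟩
    · obtain ⟨t, ht⟩ := hrun.exists_step hβ hρ₀ k hk
      exact ⟨t, fun _ => ht⟩
  have hanti : Antitone φ := antitone_nat_of_succ_le fun k => by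
    by_cases hk : linX G H (x k) (y k) (xt k - x k) = 0 ∧ linY G H (x k) (y k) (yt k - y k) = 0
    · obtain ⟨h1, h2⟩ := hrun.halt k hk.1 hk.2
      simp only [φ, h1, h2, le_refl]
    · obtain ⟨t, ht, hle, -⟩ := hrun.exists_step hβ hρ₀ k hk
      exact hle.trans (add_le_of_nonpos_right
        (mul_nonpos_of_nonneg_of_nonpos (by positivity) (hDnonpos k)))
  have hφ : Tendsto (fun k => φ k - φ (k + 1)) atTop (𝓝 0) := by
    have h := tendsto_atTop_ciInf hanti
      ⟨-1, by rintro _ ⟨k, rfl⟩; exact neg_one_le_fracObj G H _⟩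
    have := h.sub (h.comp (tendsto_add_atTop_nat 1))
    rwa [sub_self] at this
  have hD₀nonneg : 0 ≤ D₀ := by
    by_contra! hneg
    choose t ht using hstep
    have hev : ∀ᶠ k in U, D k < D₀ / 2 := hDlim.eventually_lt_const (by linarith)
    have ht0 : Tendsto t U (𝓝 0) := by
      -- Armijo with `D k < D₀ / 2` bounds `t k` by the decrement of `φ` over `α(-D₀/2)`.
      have hup : Tendsto (fun k => (φ k - φ (k + 1)) / (α * (-D₀ / 2))) U (𝓝 0) := by
        simpa using (hφ.mono_left hU).div_const (α * (-D₀ / 2))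
      refine tendsto_of_tendsto_of_tendsto_of_le_of_le' tendsto_const_nhds hup ?_ ?_
      · filter_upwards [hev] with k hk
        exact (ht k (by linarith)).1.le
      · filter_upwards [hev] with k hk
        obtain ⟨h1, h2, -⟩ := ht k (by linarith)
        rw [le_div_iff₀ (mul_pos hα₀ (by linarith))]
        nlinarith [mul_pos hα₀ h1]
    have hs0 : Tendsto (fun k => t k / ρ) U (𝓝 0) := by simpa using ht0.div_const ρ
    have hfin : α * D₀ ≤ fderiv ℝ (fracObj G H) (xb, yb) (xtb - xb, ytb - yb) := by
      refine mul_fderiv_le_of_violated_decrease (l := (U : Filter ℕ)) (z := fun k => (x k, y k))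
        (d := fun k => (xt k - x k, yt k - y k)) (contDiffAt_fracObj hGb hHb) hlim
        ((hxt.sub hx).prodMk_nhds (hyt.sub hy)) hs0 ?_ hDlim ?_
      · filter_upwards [hev] with k hk
        exact div_pos (ht k (by linarith)).1 hρ₀
      · filter_upwards [hev, ht0.eventually_lt_const hβ] with k hk hkβ
        -- Once `t k < β`, the previous trial `t k / ρ` exists and was rejected.
        exact not_le.mp ((ht k (by linarith)).2.2 hkβ)
    rw [fderiv_fracObj hGb hHb, ← hD₀] at hfin
    nlinarith
  have hX0 := linX_sub_nonpos_of_isSolution hμ₁ hxb hsx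
  have hY0 := linX_sub_nonpos_of_isSolution hμ₂ hyb hsy
  -- Both summands are nonpositive, so a nonnegative sum forces each to vanish.
  have hsum : 0 ≤ linX G H xb yb (xtb - xb) + linX H G yb xb (ytb - yb) := by
    rw [hD₀, linY_eq_linX] at hD₀nonneg
    have := mul_nonneg hD₀nonneg (mul_nonneg (norm_nonneg (G xb)) (norm_nonneg (H yb)))
    rwa [div_mul_cancel₀ _
      (mul_ne_zero (norm_ne_zero_iff.mpr hGb) (norm_ne_zero_iff.mpr hHb))] at this
  rw [linX_sub, linX_self hGb hHb] at hX0 hsum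
  rw [linX_sub, linX_self hHb hGb] at hY0 hsum
  have hLX : ∀ z ∈ JX.spectraplex, 0 ≤ linX G H xb yb z := fun z hz =>
    linX_nonneg_of_isSolution hμ₁ hxb hGb hHb hsx (by linarith) hz
  have hLY : ∀ z ∈ JY.spectraplex, 0 ≤ linX H G yb xb z := fun z hz =>
    linX_nonneg_of_isSolution hμ₂ hyb hHb hGb hsy (by linarith) hz
  refine ⟨⟨(contDiffAt_fracObj hGb hHb).differentiableAt one_ne_zero,
    differentiableAt_inner_sub_const _ _, differentiableAt_inner_sub_const _ _, 0, 0, complementarity_of_linX_nonneg hxb hGb hHb hLX _, ?_, sub_eq_zero.mpr hxb.2,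
    sub_eq_zero.mpr hyb.2⟩, ?_⟩
  · have := complementarity_of_linX_nonneg hyb hHb hGb hLY
      (grad (fun y' => ⟪JY.one, y'⟫ - 1) yb)
    rwa [funext fun y' => fracObj_swap G H xb y'] at this
  · have hmemP : ‖G xb‖⁻¹ • G xb ∈ P := by
      rw [← map_smul]
      exact hP.map_mem (JX.smul_mem_symmCone hxb.1 (by positivity))
    have hmemQ : ‖H yb‖⁻¹ • H yb ∈ Q := by
      rw [← map_smul]
      exact hQ.map_mem (JY.smul_mem_symmCone hyb.1 (by positivity))
    refine ⟨hmemP, norm_smul_inv_norm hGb, hmemQ, norm_smul_inv_norm hHb,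
      sub_mem_dualCone_of_linX_nonneg hP hGb hHb hLX, ?_⟩
    have := sub_mem_dualCone_of_linX_nonneg hQ hHb hGb hLY
    rwa [real_inner_comm] at this
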